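/- Let $\mathbb F$ be $\mathbb R$ or $\mathbb C$, and let $d, n_1,\dots,n_d, m_1,\dots,m_d$ be nonnegative integers. Put $\mathcal X=\bigoplus_{k=1}^d \mathbb F^{n_k m_k}$, $\mathcal U_1=\mathcal Y_1=\mathbb F^p$, $\mathcal U_2=\mathbb F^q$, $\mathcal Y_2=\mathbb F^r$, and let $$\boldsymbol\Delta=\{\operatorname{diag}(\Delta^0_1\otimes I_{n_1},\dots,\Delta^0_d\otimes I_{n_d}) : \Delta^0_k\in\mathbb F^{m_k\times m_k}\}\subset\mathcal L(\mathcal X).$$ For a set $\boldsymbol S$ of square matrices let $\mathcal D_{\boldsymbol S}$ be its commutant $\{Q : QD=DQ \text{ for all } D\in\boldsymbol S\}$. A square matrix $M$ is called $\mathcal Q$-stable with respect to $\boldsymbol S$ if $\|Q^{-1}MQ\|<1$ (Euclidean operator norm) for some invertible $Q\in\mathcal D_{\boldsymbol S}$. Let a plant (LFT model) $$\begin{bmatrix} A&B_1&B_2\\ C_1&D_{11}&D_{12}\\ C_2&D_{21}&D_{22}\end{bmatrix}:\ \mathcal X\oplus\mathcal U_1\oplus\mathcal U_2\to\mathcal X\oplus\mathcal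 Y_1\oplus\mathcal Y_2$$ with uncertainty structure $\boldsymbol\Delta$ be given. A controller with access to the full block consists of nonnegative integers $n_{K1},\dots,n_{Kd},n_f$, a state space $\mathcal X_K=\bigoplus_{k=1}^d\mathbb F^{n_{Kk}m_k}\ \oplus\ \mathbb F^{p\, n_f}$ and a matrix $\begin{bmatrix}A_K&B_K\\ C_K&D_K\end{bmatrix}:\mathcal X_K\oplus\mathcal Y_2\to\mathcal X_K\oplus\mathcal U_2$ such that the feedback loop is well-posed, i.e. $I-D_{22}D_K$ is invertible (this is automatic if $D_{22}=0$). Its closed-loop system matrix on $(\mathcal X\oplus\mathcal X_K)\oplus\mathcal U_1$ is $$\begin{bmatrix}A_{cl}&B_{cl}\\ C_{cl}&D_{cl}\end{bmatrix}=\mathcal F_\ell\left(\left[\begin{array}{ccc|cc}A&0&B_1&0&B_2\\ 0&0&0&I&0\\ C_1&0&D_{11}&0&D_{12}\\ \hline 0&I&0&0&0\\ C_2&0&D_{21}&0&D_{22}\end{array}\right],\begin{bmatrix}A_K&B_K\\ C_K&D_K\end{bmatrix}\right),$$ where $\mathcal F_\ell\left(\begin{bmatrix}a&b\\ c&e\end{bmatrix},K\right)=a+b(I-Ke)^{-1}Kc$.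 The plant uncertainty and the artificial full-block uncertainty $\Delta_{\rm full}\in\mathcal L(\mathcal U_1)$, which feeds the error $y_1$ back to the disturbance $u_1$, are both shared with the controller: the closed-loop uncertainty structure $\boldsymbol\Delta_{sh}$ consists of all $$\operatorname{diag}\bigl(\Delta^0_1\otimes I_{n_1},\dots,\Delta^0_d\otimes I_{n_d},\ \Delta^0_1\otimes I_{n_{K1}},\dots,\Delta^0_d\otimes I_{n_{Kd}},\ \Delta_{\rm full}\otimes I_{n_f},\ \Delta_{\rm full}\bigr)$$ acting on $\mathcal X\oplus\mathcal X_K\oplus\mathcal U_1$, with arbitrary $\Delta_k^0\in\mathbb F^{m_k\times m_k}$ and $\Delta_{\rm full}\in\mathbb F^{p\times p}$. The controller achieves closed-loop $\mathcal Q$-performance if $\begin{bmatrix}A_{cl}&B_{cl}\\ C_{cl}&D_{cl}\end{bmatrix}$ is $\mathcal Q$-stable with respect to $\boldsymbol\Delta_{sh}$. Let $N_c$ and $N_o$ be any injective matrices with $\operatorname{Im}N_c=\operatorname{Ker}\begin{bmatrix}B_2^*&D_{12}^*\end{bmatrix}$ and $\operatorname{Im}N_o=\operatorname{Ker}\begin{bmatrix}C_2&D_{21}\end{bmatrix}$.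 **Theorem.** A controller with access to the full block (with no restriction on $n_{K1},\dots,n_{Kd},n_f$) which achieves closed-loop $\mathcal Q$-performance exists if and only if there are positive-definite $X,Y\in\mathcal D_{\boldsymbol\Delta}$ such that $$\begin{bmatrix}N_c&0\\0&I\end{bmatrix}^*\begin{bmatrix}AYA^*-Y&AYC_1^*&B_1\\ C_1YA^*&C_1YC_1^*-I&D_{11}\\ B_1^*&D_{11}^*&-I\end{bmatrix}\begin{bmatrix}N_c&0\\0&I\end{bmatrix}<0,$$ $$\begin{bmatrix}N_o&0\\0&I\end{bmatrix}^*\begin{bmatrix}A^*XA-X&A^*XB_1&C_1^*\\ B_1^*XA&B_1^*XB_1-I&D_{11}^*\\ C_1&D_{11}&-I\end{bmatrix}\begin{bmatrix}N_o&0\\0&I\end{bmatrix}<0.$$ -/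

import Mathlib

open Matrix
open scoped Kronecker ComplexOrder

noncomputable section

/-- Coordinates of the state space `𝒳 = ⨁ₖ 𝕜^(nₖ · mₖ)`: the `k`-th summand consists of `mₖ` blocks
of length `nₖ`. -/
abbrev StateIdx {d : ℕ} (m n : Fin d → ℕ) : Type := (k : Fin d) × (Fin (m k) × Fin (n k))

/-- The block-diagonal matrix `diag (Δ⁰₁ ⊗ I_{n₁}, …, Δ⁰_d ⊗ I_{n_d})`. -/
def uncertainty {𝕜 : Type*} [RCLike 𝕜] {d : ℕ} (m n : Fin d → ℕ)
    (δ : (k : Fin d) → Matrix (Fin (m k)) (Fin (m k)) 𝕜) :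
    Matrix (StateIdx m n) (StateIdx m n) 𝕜 :=
  Matrix.blockDiagonal' fun k => δ k ⊗ₖ (1 : Matrix (Fin (n k)) (Fin (n k)) 𝕜)

/-- The uncertainty structure `𝚫`: all `diag (Δ⁰₁ ⊗ I_{n₁}, …, Δ⁰_d ⊗ I_{n_d})`, where `Δ⁰ₖ` is an
arbitrary `mₖ × mₖ` matrix. -/
def uncertaintyStructure (𝕜 : Type*) [RCLike 𝕜] {d : ℕ} (m n : Fin d → ℕ) :
    Set (Matrix (StateIdx m n) (StateIdx m n) 𝕜) :=
  Set.range (uncertainty m n)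

/-- The commutant of a set of square matrices. -/
def commutant {𝕜 : Type*} [RCLike 𝕜] {ι : Type*} [Fintype ι] (S : Set (Matrix ι ι 𝕜)) :
    Set (Matrix ι ι 𝕜) :=
  {Q | ∀ D ∈ S, Q * D = D * Q}

open scoped Matrix.Norms.L2Operator in
/-- `𝒬`-stability of `M` with respect to the structure `S`: there is an invertible `Q` in the
commutant of `S` such that `‖Q⁻¹ M Q‖ < 1`, where the norm is the operator norm that is induced by
the Euclidean norm. -/
def QStable {𝕜 : Type*} [RCLike 𝕜] {ι : Type*} [Fintype ι] [DecidableEq ι]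
    (S : Set (Matrix ι ι 𝕜)) (M : Matrix ι ι 𝕜) : Prop :=
  ∃ Q ∈ commutant S, IsUnit Q ∧ ‖Q⁻¹ * M * Q‖ < 1

/-- The system matrix of a plant
`[A B₁ B₂; C₁ D₁₁ D₁₂; C₂ D₂₁ D₂₂] : 𝒳 ⊕ 𝒰₁ ⊕ 𝒰₂ → 𝒳 ⊕ 𝒴₁ ⊕ 𝒴₂`, where the coordinates of `𝒳` are
indexed by `χ`, and `𝒰₁ = 𝒴₁ = 𝕜^p`, `𝒰₂ = 𝕜^q`, `𝒴₂ = 𝕜^r`. -/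
structure Plant (𝕜 : Type*) (χ : Type*) (p q r : ℕ) where
  A : Matrix χ χ 𝕜
  B₁ : Matrix χ (Fin p) 𝕜
  B₂ : Matrix χ (Fin q) 𝕜
  C₁ : Matrix (Fin p) χ 𝕜
  C₂ : Matrix (Fin r) χ 𝕜
  D₁₁ : Matrix (Fin p) (Fin p) 𝕜
  D₁₂ : Matrix (Fin p) (Fin q) 𝕜
  D₂₁ : Matrix (Fin r) (Fin p) 𝕜
  D₂₂ : Matrix (Fin r) (Fin q) 𝕜

/-- The system matrix of a controller
`[A_K B_K; C_K D_K] : 𝒳_K ⊕ 𝒴₂ → 𝒳_K ⊕ 𝒰₂`, where the coordinates of `𝒳_K` are indexed by `κ`. -/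
structure Controller (𝕜 : Type*) (κ : Type*) (q r : ℕ) where
  A : Matrix κ κ 𝕜
  B : Matrix κ (Fin r) 𝕜
  C : Matrix (Fin q) κ 𝕜
  D : Matrix (Fin q) (Fin r) 𝕜

/-- The lower linear fractional transformation of `[A B; C D]` with load `K`:
`A + B (I - K D)⁻¹ K C`. -/
def lowerLFT {𝕜 : Type*} [RCLike 𝕜] {a b y u : Type*} [Fintype y] [Fintype u] [DecidableEq u]
    (A : Matrix a b 𝕜) (B : Matrix a u 𝕜) (C : Matrix y b 𝕜) (D : Matrix y u 𝕜)
    (K : Matrix u y 𝕜) : Matrix a b 𝕜 :=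
  A + B * (1 - K * D)⁻¹ * K * C

/-- The feedback loop is well-posed if `I - D₂₂ D_K` is invertible. -/
def WellPosed {𝕜 : Type*} [RCLike 𝕜] {χ κ : Type*} {p q r : ℕ}
    (P : Plant 𝕜 χ p q r) (K : Controller 𝕜 κ q r) : Prop :=
  IsUnit (1 - P.D₂₂ * K.D)

/-- The closed-loop system matrix `[A_cl B_cl; C_cl D_cl]` on `(𝒳 ⊕ 𝒳_K) ⊕ 𝒰₁`: the lower linear
fractional transformation with load `[A_K B_K; C_K D_K]` of
```
[ A   0  B₁  | 0  B₂  ]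
[ 0   0  0   | I  0   ]
[ C₁  0  D₁₁ | 0  D₁₂ ]
[---------------------]
[ 0   I  0   | 0  0   ]
[ C₂  0  D₂₁ | 0  D₂₂ ]
```
-/
def closedLoop {𝕜 : Type*} [RCLike 𝕜] {χ κ : Type*} [Fintype χ] [Fintype κ] [DecidableEq κ]
    {p q r : ℕ} (P : Plant 𝕜 χ p q r) (K : Controller 𝕜 κ q r) :
    Matrix ((χ ⊕ κ) ⊕ Fin p) ((χ ⊕ κ) ⊕ Fin p) 𝕜 :=
  lowerLFT
    (fromBlocks (fromBlocks P.A 0 0 0) (fromRows P.B₁ 0) (fromCols P.C₁ 0) P.D₁₁)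
    (fromRows (fromBlocks 0 P.B₂ 1 0) (fromCols 0 P.D₁₂))
    (fromCols (fromBlocks 0 1 P.C₂ 0) (fromRows 0 P.D₂₁))
    (fromBlocks 0 0 0 P.D₂₂)
    (fromBlocks K.A K.B K.C K.D)

/-- Coordinates of the state space of a controller that has access to the full block: the
partial states `(x_{K1}, …, x_{Kd})`, which are fed back through `Δ⁰ₖ ⊗ I_{n_{Kk}}`, and the
partial state `z`, which is fed back through `Δ⁰_full ⊗ I_{nf}`. -/
abbrev ControllerIdx {d : ℕ} (m nK : Fin d → ℕ) (p nf : ℕ) : Type :=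
  StateIdx m nK ⊕ (Fin p × Fin nf)

/-- The uncertainty structure of the closed loop in which both the plant uncertainty and the
artificial full-block uncertainty (which maps the error to the disturbance) are shared with the
controller: all matrices
`diag (diag (Δ⁰ₖ ⊗ I_{nₖ})ₖ, diag (Δ⁰ₖ ⊗ I_{n_{Kk}})ₖ, Δ_full ⊗ I_{nf}, Δ_full)` on
`𝒳 ⊕ 𝒳_K ⊕ 𝒰₁`, where the `Δ⁰ₖ` and `Δ_full ∈ ℒ(𝒰₁)` are arbitrary. -/
def sharedClosedLoopStructure (𝕜 : Type*) [RCLike 𝕜] {d : ℕ} (m n nK : Fin d → ℕ) (p nf : ℕ) :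
    Set (Matrix ((StateIdx m n ⊕ ControllerIdx m nK p nf) ⊕ Fin p)
      ((StateIdx m n ⊕ ControllerIdx m nK p nf) ⊕ Fin p) 𝕜) :=
  {E | ∃ (δ : (k : Fin d) → Matrix (Fin (m k)) (Fin (m k)) 𝕜) (δf : Matrix (Fin p) (Fin p) 𝕜),
    E = fromBlocks
      (fromBlocks (uncertainty m n δ) 0 0
        (fromBlocks (uncertainty m nK δ) 0 0 (δf ⊗ₖ (1 : Matrix (Fin nf) (Fin nf) 𝕜))))
      0 0 δf}

/-- `N` is injective and its image is the kernel of `M`. -/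
def IsKernelMatrix {𝕜 : Type*} [RCLike 𝕜] {a b : Type*} [Fintype b] {c : ℕ}
    (N : Matrix b (Fin c) 𝕜) (M : Matrix a b 𝕜) : Prop :=
  Function.Injective N.mulVec ∧ LinearMap.range N.mulVecLin = LinearMap.ker M.mulVecLin

/-- The `Y`-LMI:
`diag(N, I)* [AYA* - Y, AYC₁*, B₁; C₁YA*, C₁YC₁* - I, D₁₁; B₁*, D₁₁*, -I] diag(N, I) < 0`. -/
def YLMI {𝕜 : Type*} [RCLike 𝕜] {χ : Type*} [Fintype χ] {p q r c : ℕ}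
    (P : Plant 𝕜 χ p q r) (N : Matrix (χ ⊕ Fin p) (Fin c) 𝕜) (Y : Matrix χ χ 𝕜) : Prop :=
  (-((fromBlocks N 0 0 (1 : Matrix (Fin p) (Fin p) 𝕜))ᴴ *
    fromBlocks
      (fromBlocks (P.A * Y * P.Aᴴ - Y) (P.A * Y * P.C₁ᴴ)
        (P.C₁ * Y * P.Aᴴ) (P.C₁ * Y * P.C₁ᴴ - 1))
      (fromRows P.B₁ P.D₁₁)
      (fromCols P.B₁ᴴ P.D₁₁ᴴ)
      (-1) *
    fromBlocks N 0 0 (1 : Matrix (Fin p) (Fin p) 𝕜))).PosDef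

/-- The `X`-LMI:
`diag(N, I)* [A*XA - X, A*XB₁, C₁*; B₁*XA, B₁*XB₁ - I, D₁₁*; C₁, D₁₁, -I] diag(N, I) < 0`. -/
def XLMI {𝕜 : Type*} [RCLike 𝕜] {χ : Type*} [Fintype χ] {p q r c : ℕ}
    (P : Plant 𝕜 χ p q r) (N : Matrix (χ ⊕ Fin p) (Fin c) 𝕜) (X : Matrix χ χ 𝕜) : Prop :=
  (-((fromBlocks N 0 0 (1 : Matrix (Fin p) (Fin p) 𝕜))ᴴ *
    fromBlocks
      (fromBlocks (P.Aᴴ * X * P.A - X) (P.Aᴴ * X * P.B₁)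
        (P.B₁ᴴ * X * P.A) (P.B₁ᴴ * X * P.B₁ - 1))
      (fromRows P.C₁ᴴ P.D₁₁ᴴ)
      (fromCols P.C₁ P.D₁₁)
      (-1) *
    fromBlocks N 0 0 (1 : Matrix (Fin p) (Fin p) 𝕜))).PosDef

end

/-! Because the controller may also use the full block, the disturbance channel can be treated as
part of the state. Performance becomes stabilization of the system on `𝒳 ⊕ 𝒰₁` with state matrix `M
= [A B₁; C₁ D₁₁]`, input `[B₂; D₁₂]` and output `[C₂ D₂₁]`. By Schur complements (`yLMI_iff`,
`xLMI_iff`) the two LMIs say that `diag(Y, I)` and `diag(X, I)` satisfy the Lyapunov inequalities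
for `Mᴴ` and `M` on the respective kernels.

Necessity: on `Ker [C₂ D₂₁]`, with controller state zero, the closed loop acts as `M`. A Lyapunov
matrix of the closed loop therefore compresses to one for `M` on that kernel; commuting with an
arbitrary full block makes its last block scalar, so it can be scaled to `diag(X, I)`
(`exists_plant_certificate`). The adjoint gives `Y`.

Sufficiency: `IsKernelMatrix.exists_injection` extends an inequality on the kernel to the whole
space at the price of an output injection `L`; dually one gets a state feedback `F`. An observer
estimating both state and disturbance combines them, and the separation principle
`QStable.fromBlocks_observer` needs no coupling condition between `X` and `Y`. -/

/-! ### Norm contractions, commutants and Lyapunov certificates. -/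

open scoped Matrix.Norms.L2Operator in
theorem l2_opNorm_lt_one_iff_posDef {𝕜 : Type*} [RCLike 𝕜] {ι : Type*} [Fintype ι] [DecidableEq ι]
    (T : Matrix ι ι 𝕜) : ‖T‖ < 1 ↔ (1 - Tᴴ * T).PosDef := by
  have key : ∀ x : EuclideanSpace 𝕜 ι, star x.ofLp ⬝ᵥ (1 - Tᴴ * T) *ᵥ x.ofLp =
      ((‖x‖ ^ 2 - ‖toEuclideanCLM (n := ι) (𝕜 := 𝕜) T x‖ ^ 2 : ℝ) : 𝕜) := by
    intro x
    push_cast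
    rw [← inner_self_eq_norm_sq_to_K (𝕜 := 𝕜), ← inner_self_eq_norm_sq_to_K (𝕜 := 𝕜),
      EuclideanSpace.inner_eq_star_dotProduct, EuclideanSpace.inner_eq_star_dotProduct,
      ofLp_toEuclideanCLM, sub_mulVec, dotProduct_sub, one_mulVec, ← mulVec_mulVec,
      dotProduct_mulVec _ Tᴴ, ← star_mulVec, dotProduct_comm, dotProduct_comm (T *ᵥ _)]
  constructor
  · intro h
    refine .of_dotProduct_mulVec_pos ?_ fun x hx => ?_
    · simp [IsHermitian]
    · have h1 := key (WithLp.toLp 2 x)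
      simp only at h1
      rw [h1, RCLike.ofReal_pos]
      have h0 : 0 < ‖WithLp.toLp 2 x‖ := by simpa using hx
      have h2 := (toEuclideanCLM (n := ι) (𝕜 := 𝕜) T).le_opNorm (WithLp.toLp 2 x)
      rw [← cstar_norm_def] at h2
      have h3 : ‖toEuclideanCLM (n := ι) (𝕜 := 𝕜) T (WithLp.toLp 2 x)‖ < ‖WithLp.toLp 2 x‖ :=
        h2.trans_lt (by nlinarith)
      nlinarith [norm_nonneg (toEuclideanCLM (n := ι) (𝕜 := 𝕜) T (WithLp.toLp 2 x))]
  · intro h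
    have hlt : ∀ x : EuclideanSpace 𝕜 ι, x ≠ 0 → ‖toEuclideanCLM (n := ι) (𝕜 := 𝕜) T x‖ < ‖x‖ := by
      intro x hx
      have h1 := h.dotProduct_mulVec_pos (x := x.ofLp) (by simpa using hx)
      rw [key, RCLike.ofReal_pos] at h1
      exact lt_of_pow_lt_pow_left₀ 2 (norm_nonneg _) (by linarith)
    rw [cstar_norm_def]
    rcases isEmpty_or_nonempty ι with hι | hι
    · rw [Subsingleton.elim (toEuclideanCLM (n := ι) (𝕜 := 𝕜) T) 0]
      simp
    · have hne : (Metric.sphere (0 : EuclideanSpace 𝕜 ι) 1).Nonempty :=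
        ⟨EuclideanSpace.single hι.some 1, by simp⟩
      -- Compactness of the unit sphere turns the pointwise strict bound into a strict bound on the
      -- norm.
      obtain ⟨x, hx, hmax⟩ := (isCompact_sphere (0 : EuclideanSpace 𝕜 ι) 1).exists_isMaxOn hne
        (f := fun x => ‖toEuclideanCLM (n := ι) (𝕜 := 𝕜) T x‖) (by fun_prop)
      have hx1 : ‖x‖ = 1 := by simpa using hx
      have hx0 : x ≠ 0 := by rintro rfl; simp at hx1
      refine lt_of_le_of_lt ?_ (hx1 ▸ hlt x hx0)
      exact ContinuousLinearMap.opNorm_le_of_unit_norm (𝕜 := 𝕜) (norm_nonneg _)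
        fun y hy => hmax (by simpa using hy)

theorem mul_mem_commutant {𝕜 : Type*} [RCLike 𝕜] {ι : Type*} [Fintype ι] {S : Set (Matrix ι ι 𝕜)}
    {P Q : Matrix ι ι 𝕜} (hP : P ∈ commutant S) (hQ : Q ∈ commutant S) : P * Q ∈ commutant S :=
  fun D hD => by rw [Matrix.mul_assoc, hQ D hD, ← Matrix.mul_assoc, hP D hD, Matrix.mul_assoc]

theorem inv_mem_commutant {𝕜 : Type*} [RCLike 𝕜] {ι : Type*} [Fintype ι] [DecidableEq ι]
    {S : Set (Matrix ι ι 𝕜)} {Q : Matrix ι ι 𝕜} (hQ : Q ∈ commutant S) (hu : IsUnit Q) :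
    Q⁻¹ ∈ commutant S := fun D hD => by
  have hd := (Matrix.isUnit_iff_isUnit_det _).1 hu
  calc Q⁻¹ * D = Q⁻¹ * (D * Q) * Q⁻¹ := by
        rw [Matrix.mul_assoc, Matrix.mul_assoc, Matrix.mul_nonsing_inv _ hd, Matrix.mul_one]
    _ = D * Q⁻¹ := by
        rw [← hQ D hD, ← Matrix.mul_assoc, Matrix.nonsing_inv_mul _ hd, Matrix.one_mul]

theorem conjTranspose_mem_commutant {𝕜 : Type*} [RCLike 𝕜] {ι : Type*} [Fintype ι]
    {S : Set (Matrix ι ι 𝕜)} (hS : ∀ D ∈ S, Dᴴ ∈ S) {Q : Matrix ι ι 𝕜} (hQ : Q ∈ commutant S) :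
    Qᴴ ∈ commutant S := fun D hD => by
  have := congrArg Matrix.conjTranspose (hQ _ (hS D hD))
  simpa using this.symm

theorem QStable.conjTranspose {𝕜 : Type*} [RCLike 𝕜] {ι : Type*} [Fintype ι] [DecidableEq ι]
    {S : Set (Matrix ι ι 𝕜)} (hS : ∀ D ∈ S, Dᴴ ∈ S) {M : Matrix ι ι 𝕜} (h : QStable S M) :
    QStable S Mᴴ := by
  obtain ⟨Q, hQ, hu, hn⟩ := h
  have hu' : IsUnit Qᴴ := by simpa [Matrix.isUnit_iff_isUnit_det] using hu
  have hd := (Matrix.isUnit_iff_isUnit_det _).1 hu'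
  refine ⟨Qᴴ⁻¹, inv_mem_commutant (conjTranspose_mem_commutant hS hQ) hu', by simpa using hu', ?_⟩
  rw [← l2_opNorm_conjTranspose] at hn
  rw [Matrix.nonsing_inv_nonsing_inv _ hd]
  simpa [conjTranspose_nonsing_inv, Matrix.mul_assoc] using hn

/-- Lyapunov characterization of `𝒬`-stability. -/
theorem QStable.exists_posDef {𝕜 : Type*} [RCLike 𝕜] {ι : Type*} [Fintype ι]
    [DecidableEq ι] {S : Set (Matrix ι ι 𝕜)} (hS : ∀ D ∈ S, Dᴴ ∈ S) {M : Matrix ι ι 𝕜}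
    (h : QStable S M) :
    ∃ P ∈ commutant S, P.PosDef ∧ (P - Mᴴ * P * M).PosDef := by
  obtain ⟨Q, hQ, hu, hn⟩ := h
  have hui : IsUnit Q⁻¹ := by simpa using hu
  have hd := (Matrix.isUnit_iff_isUnit_det _).1 hu
  -- With this choice the Lyapunov inequality is the congruence by `Q⁻¹` of the norm bound for `Q⁻¹
  -- M Q`.
  refine ⟨Q⁻¹ᴴ * Q⁻¹, mul_mem_commutant
    (conjTranspose_mem_commutant hS (inv_mem_commutant hQ hu)) (inv_mem_commutant hQ hu), ?_, ?_⟩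
  · simpa [star_eq_conjTranspose] using
      (Matrix.IsUnit.posDef_star_left_conjugate_iff (x := 1) hui).2 .one
  · rw [l2_opNorm_lt_one_iff_posDef] at hn
    have := (Matrix.IsUnit.posDef_star_left_conjugate_iff hui).2 hn
    convert this using 1
    simp only [star_eq_conjTranspose, Matrix.mul_sub, Matrix.sub_mul, conjTranspose_mul,
      Matrix.mul_assoc, Matrix.mul_nonsing_inv _ hd, Matrix.mul_one]
    rw [← Matrix.mul_assoc Q⁻¹ᴴ Qᴴ, ← conjTranspose_mul, Matrix.mul_nonsing_inv _ hd]
    simp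

-- The square root comes from the functional calculus of `P`, so it commutes with everything that
-- commutes with `P`.
open scoped MatrixOrder Matrix.Norms.L2Operator in
theorem exists_posDef_sqrt {𝕜 : Type*} [RCLike 𝕜] {ι : Type*} [Fintype ι]
    [DecidableEq ι] {S : Set (Matrix ι ι 𝕜)} {P : Matrix ι ι 𝕜} (hP : P.PosDef)
    (hPS : P ∈ commutant S) : ∃ R ∈ commutant S, Rᴴ = R ∧ IsUnit R ∧ R * R = P := by
  have h0 : (0 : Matrix ι ι 𝕜) ≤ P := hP.posSemidef.nonneg
  refine ⟨CFC.sqrt P, fun D hD => ?_, (CFC.sqrt_nonneg P).posSemidef.isHermitian, ?_,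
    CFC.sqrt_mul_sqrt_self P h0⟩
  · rw [CFC.sqrt_eq_cfc]
    exact Commute.cfc_nnreal (hPS D hD) _
  · refine isUnit_of_mul_isUnit_left (y := CFC.sqrt P) ?_
    rw [CFC.sqrt_mul_sqrt_self P h0]
    exact hP.isUnit

theorem QStable.of_posDef {𝕜 : Type*} [RCLike 𝕜] {ι : Type*} [Fintype ι]
    [DecidableEq ι] {S : Set (Matrix ι ι 𝕜)} {M P : Matrix ι ι 𝕜} (hPS : P ∈ commutant S)
    (hP : P.PosDef) (h : (P - Mᴴ * P * M).PosDef) : QStable S M := by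
  obtain ⟨R, hR, hRh, hu, rfl⟩ := exists_posDef_sqrt hP hPS
  have hd := (Matrix.isUnit_iff_isUnit_det _).1 hu
  have hui : IsUnit R⁻¹ := by simpa using hu
  refine ⟨R⁻¹, inv_mem_commutant hR hu, hui, ?_⟩
  rw [l2_opNorm_lt_one_iff_posDef, Matrix.nonsing_inv_nonsing_inv _ hd]
  convert (Matrix.IsUnit.posDef_star_left_conjugate_iff hui).2 h using 1
  simp only [star_eq_conjTranspose, Matrix.mul_sub, Matrix.sub_mul, conjTranspose_mul,
    conjTranspose_nonsing_inv, hRh, Matrix.mul_assoc, Matrix.mul_nonsing_inv _ hd, Matrix.mul_one,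
    Matrix.nonsing_inv_mul _ hd]

/-! ### Kernel matrices and output injection. -/

theorem IsKernelMatrix.mul_eq_zero {𝕜 : Type*} [RCLike 𝕜] {a b : Type*} [Fintype b] {c : ℕ}
    {N : Matrix b (Fin c) 𝕜} {C : Matrix a b 𝕜} (h : IsKernelMatrix N C) : C * N = 0 := by
  refine Matrix.ext_of_mulVec_single fun i => ?_
  have : N *ᵥ Pi.single i 1 ∈ LinearMap.ker C.mulVecLin := h.2 ▸ ⟨_, rfl⟩
  rw [← mulVec_mulVec, zero_mulVec]
  simpa only [LinearMap.mem_ker, mulVecLin_apply] using this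

/-- A linear map that vanishes on the kernel of `C` factors through `C`. -/
theorem IsKernelMatrix.exists_mul_eq {𝕜 : Type*} [RCLike 𝕜] {a b e : Type*} [Fintype a] [Fintype b]
    [DecidableEq a] [DecidableEq b] {c : ℕ} {N : Matrix b (Fin c) 𝕜} {C : Matrix a b 𝕜}
    (h : IsKernelMatrix N C) {T : Matrix e b 𝕜} (hT : T * N = 0) :
    ∃ W : Matrix e a 𝕜, W * C = T := by
  have hker : LinearMap.ker C.mulVecLin ≤ LinearMap.ker T.mulVecLin := by
    rw [← h.2]
    rintro _ ⟨w, rfl⟩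
    simp [mulVec_mulVec, hT]
  obtain ⟨g, hg⟩ := (LinearMap.exists_extend
    (((LinearMap.ker C.mulVecLin).liftQ T.mulVecLin hker).comp
      C.mulVecLin.quotKerEquivRange.symm.toLinearMap))
  refine ⟨LinearMap.toMatrix' g, Matrix.ext_of_mulVec_single fun i => ?_⟩
  rw [← mulVec_mulVec, LinearMap.toMatrix'_mulVec]
  have := LinearMap.congr_fun hg ⟨C *ᵥ Pi.single i 1, ⟨_, rfl⟩⟩
  simp only [LinearMap.comp_apply, Submodule.subtype_apply] at this
  rw [this]
  have h2 : C.mulVecLin.quotKerEquivRange.symm ⟨C *ᵥ Pi.single i 1, ⟨Pi.single i 1, rfl⟩⟩ =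
      Submodule.Quotient.mk (Pi.single i 1) := by
    rw [LinearEquiv.symm_apply_eq]; rfl
  simp only [LinearEquiv.coe_coe]
  rw [h2]
  simp

/-- Output injection: a Lyapunov inequality on the kernel of `C` can be made to hold everywhere. -/
theorem IsKernelMatrix.exists_injection {𝕜 : Type*} [RCLike 𝕜] {a b : Type*} [Fintype a]
    [Fintype b] [DecidableEq a] [DecidableEq b] {c : ℕ} {N : Matrix b (Fin c) 𝕜} {C : Matrix a b 𝕜}
    (h : IsKernelMatrix N C) {M X : Matrix b b 𝕜} (hX : X.PosDef)
    (hN : (Nᴴ * (X - Mᴴ * X * M) * N).PosDef) :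
    ∃ L : Matrix b a 𝕜, (X - (M + L * C)ᴴ * X * (M + L * C)).PosDef := by
  set G := Nᴴ * X * N with hG
  have hGpos : G.PosDef := hX.conjTranspose_mul_mul_same h.1
  have hGd := (Matrix.isUnit_iff_isUnit_det _).1 hGpos.isUnit
  have hGH : G⁻¹ᴴ = G⁻¹ := by rw [conjTranspose_nonsing_inv, hGpos.isHermitian.eq]
  -- `E` is the `X`-orthogonal projection onto `Im N = Ker C`.
  set E := N * G⁻¹ * Nᴴ * X with hE
  have hEN : E * N = N := by
    rw [hE, show N * G⁻¹ * Nᴴ * X * N = N * G⁻¹ * G by simp only [hG, Matrix.mul_assoc],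
      Matrix.mul_assoc, Matrix.nonsing_inv_mul _ hGd, Matrix.mul_one]
  -- The gain is chosen so that `M + W C = M E`: the injection cancels `M` on the `X`-orthogonal
  -- complement of the kernel.
  obtain ⟨W, hW⟩ := h.exists_mul_eq (T := M * (E - 1)) (by
    rw [Matrix.mul_assoc, Matrix.sub_mul, hEN, Matrix.one_mul, sub_self, Matrix.mul_zero])
  have hXE : X * E = Eᴴ * X * E := by
    have : Eᴴ * X * N = X * N := by
      have h1 : Eᴴ = X * N * G⁻¹ * Nᴴ := by
        simp [hE, conjTranspose_mul, hGH, hX.isHermitian.eq, Matrix.mul_assoc]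
      rw [h1, show X * N * G⁻¹ * Nᴴ * X * N = X * N * (G⁻¹ * G) by
        simp only [hG, Matrix.mul_assoc], Matrix.nonsing_inv_mul _ hGd, Matrix.mul_one]
    rw [show Eᴴ * X * E = Eᴴ * X * N * (G⁻¹ * Nᴴ * X) by
      simp only [hE, Matrix.mul_assoc], this]
    simp only [hE, Matrix.mul_assoc]
  have hEX : Eᴴ * X = Eᴴ * X * E := by
    have := congrArg Matrix.conjTranspose hXE
    simpa [conjTranspose_mul, hX.isHermitian.eq, Matrix.mul_assoc] using this
  refine ⟨W, ?_⟩
  have hsplit : X - (M + W * C)ᴴ * X * (M + W * C) =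
      (1 - E)ᴴ * X * (1 - E) + (G⁻¹ * Nᴴ * X)ᴴ * (Nᴴ * (X - Mᴴ * X * M) * N) * (G⁻¹ * Nᴴ * X) := by
    have h1 : M + W * C = M * E := by rw [hW, Matrix.mul_sub, Matrix.mul_one]; abel
    have h2 : (G⁻¹ * Nᴴ * X)ᴴ * (Nᴴ * (X - Mᴴ * X * M) * N) * (G⁻¹ * Nᴴ * X) =
        Eᴴ * (X - Mᴴ * X * M) * E := by
      rw [show E = N * (G⁻¹ * Nᴴ * X) by simp only [hE, Matrix.mul_assoc], conjTranspose_mul N]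
      simp only [Matrix.mul_assoc]
    rw [h1, h2, conjTranspose_mul, conjTranspose_sub, conjTranspose_one]
    simp only [Matrix.mul_sub, Matrix.sub_mul, Matrix.mul_one, Matrix.one_mul]
    rw [← hEX, hXE, ← hEX]
    simp only [Matrix.mul_assoc]
    abel
  rw [hsplit]
  have hpsd1 := hX.posSemidef.conjTranspose_mul_mul_same (1 - E)
  have hpsd2 := hN.posSemidef.conjTranspose_mul_mul_same (G⁻¹ * Nᴴ * X)
  refine .of_dotProduct_mulVec_pos (hpsd1.isHermitian.add hpsd2.isHermitian) fun v hv => ?_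
  rw [add_mulVec, dotProduct_add]
  -- These are the coordinates of `E v` in the columns of `N`. If they vanish, the first summand is
  -- `v* X v`; otherwise the hypothesis on the kernel makes the second one positive.
  by_cases hz : (G⁻¹ * Nᴴ * X) *ᵥ v = 0
  · refine add_pos_of_pos_of_nonneg ?_ (hpsd2.dotProduct_mulVec_nonneg v)
    have hEv : (1 - E) *ᵥ v = v := by
      rw [sub_mulVec, show E = N * (G⁻¹ * Nᴴ * X) by simp only [hE, Matrix.mul_assoc],
        ← mulVec_mulVec, hz, mulVec_zero, one_mulVec, sub_zero]
    rw [← mulVec_mulVec, hEv, ← mulVec_mulVec, dotProduct_mulVec, ← star_mulVec, hEv]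
    exact hX.dotProduct_mulVec_pos hv
  · refine add_pos_of_nonneg_of_pos (hpsd1.dotProduct_mulVec_nonneg v) ?_
    rw [← mulVec_mulVec, ← mulVec_mulVec, dotProduct_mulVec, ← star_mulVec]
    exact hN.dotProduct_mulVec_pos hz

/-! ### Stability under block-triangular composition and changes of coordinates. -/

theorem posDef_fromBlocks_diag {R : Type*} [Ring R] [PartialOrder R] [StarRing R]
    [StarOrderedRing R] {ι κ : Type*} [Fintype ι]
    [Fintype κ] {A : Matrix ι ι R} {B : Matrix κ κ R} (hA : A.PosDef) (hB : B.PosDef) :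
    (fromBlocks A 0 0 B).PosDef := by
  refine .of_dotProduct_mulVec_pos (hA.isHermitian.fromBlocks (by simp) hB.isHermitian)
    fun v hv => ?_
  obtain ⟨x, y, rfl⟩ : ∃ x y, v = Sum.elim x y := ⟨_, _, (Sum.elim_comp_inl_inr v).symm⟩
  have hs : star (Sum.elim x y) = Sum.elim (star x) (star y) := by
    ext (i | i) <;> rfl
  rw [fromBlocks_mulVec, hs, sumElim_dotProduct_sumElim]
  simp only [Sum.elim_comp_inl, Sum.elim_comp_inr, zero_mulVec, add_zero, zero_add]
  by_cases hx : x = 0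
  · have hy : y ≠ 0 := by
      rintro rfl
      exact hv (by subst hx; ext (i | i) <;> rfl)
    exact add_pos_of_nonneg_of_pos (hA.posSemidef.dotProduct_mulVec_nonneg x)
      (hB.dotProduct_mulVec_pos hy)
  · exact add_pos_of_pos_of_nonneg (hA.dotProduct_mulVec_pos hx)
      (hB.posSemidef.dotProduct_mulVec_nonneg y)

-- Scaling the second block by a small `ε` commutes with the block-diagonal structure, keeps the
-- diagonal blocks and multiplies the coupling by `ε`.
open scoped Matrix.Norms.L2Operator in
theorem QStable.fromBlocks_upper {𝕜 : Type*} [RCLike 𝕜] {ι κ : Type*} [Fintype ι] [DecidableEq ι]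
    [Fintype κ] [DecidableEq κ] {S : Set (Matrix ι ι 𝕜)} {S' : Set (Matrix κ κ 𝕜)}
    {a : Matrix ι ι 𝕜} {b : Matrix ι κ 𝕜} {c : Matrix κ κ 𝕜} (ha : QStable S a)
    (hc : QStable S' c) :
    QStable {E | ∃ D ∈ S, ∃ D' ∈ S', E = fromBlocks D 0 0 D'} (fromBlocks a b 0 c) := by
  obtain ⟨Q, hQ, hQu, hQn⟩ := ha
  obtain ⟨R, hR, hRu, hRn⟩ := hc
  have hQd := (Matrix.isUnit_iff_isUnit_det _).1 hQu
  have hRd := (Matrix.isUnit_iff_isUnit_det _).1 hRu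
  set Δ : Matrix (ι ⊕ κ) (ι ⊕ κ) 𝕜 := fromBlocks (Q⁻¹ * a * Q) 0 0 (R⁻¹ * c * R) with hΔ
  set β : Matrix (ι ⊕ κ) (ι ⊕ κ) 𝕜 := fromBlocks 0 (Q⁻¹ * b * R) 0 0 with hβ
  have hΔn : ‖Δ‖ < 1 := by
    rw [l2_opNorm_lt_one_iff_posDef] at hQn hRn ⊢
    convert posDef_fromBlocks_diag hQn hRn using 1
    rw [hΔ, fromBlocks_conjTranspose, fromBlocks_multiply, ← fromBlocks_one, sub_eq_add_neg,
      fromBlocks_neg, fromBlocks_add]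
    simp [sub_eq_add_neg]
  obtain ⟨ε, hε, hεn⟩ : ∃ ε : 𝕜, ε ≠ 0 ∧ ‖Δ‖ + ‖ε‖ * ‖β‖ < 1 := by
    have h1 : (1 - ‖Δ‖) / (‖β‖ + 1) * (‖β‖ + 1) = 1 - ‖Δ‖ := by
      field_simp
    have h2 : 0 < (1 - ‖Δ‖) / (‖β‖ + 1) := div_pos (by linarith) (by positivity)
    refine ⟨((1 - ‖Δ‖) / (‖β‖ + 1) : ℝ), by exact_mod_cast h2.ne', ?_⟩
    rw [RCLike.norm_ofReal, abs_of_pos h2]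
    nlinarith
  set T : Matrix (ι ⊕ κ) (ι ⊕ κ) 𝕜 := fromBlocks Q 0 0 (ε • R) with hT
  set T' : Matrix (ι ⊕ κ) (ι ⊕ κ) 𝕜 := fromBlocks Q⁻¹ 0 0 (ε⁻¹ • R⁻¹) with hT'
  have hTT : T' * T = 1 := by
    rw [hT, hT', fromBlocks_multiply]
    simp [Matrix.nonsing_inv_mul _ hQd, Matrix.nonsing_inv_mul _ hRd, smul_smul, hε]
  refine ⟨T, ?_, IsUnit.of_mul_eq_one_right _ hTT, ?_⟩
  · rintro _ ⟨D, hD, D', hD', rfl⟩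
    rw [hT, fromBlocks_multiply, fromBlocks_multiply]
    simp [hQ D hD, hR D' hD']
  · rw [Matrix.inv_eq_left_inv hTT]
    have : T' * fromBlocks a b 0 c * T = Δ + ε • β := by
      rw [hT, hT', hΔ, hβ, fromBlocks_multiply, fromBlocks_multiply, fromBlocks_smul,
        fromBlocks_add]
      simp [smul_smul, hε]
    rw [this]
    calc _ ≤ ‖Δ‖ + ‖ε • β‖ := norm_add_le _ _
      _ = ‖Δ‖ + ‖ε‖ * ‖β‖ := by rw [norm_smul]
      _ < 1 := hεn

theorem QStable.of_similar {𝕜 : Type*} [RCLike 𝕜] {ι : Type*} [Fintype ι] [DecidableEq ι]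
    {S : Set (Matrix ι ι 𝕜)} {M T T' : Matrix ι ι 𝕜} (hT : T ∈ commutant S) (hTT : T' * T = 1)
    (h : QStable S (T' * M * T)) : QStable S M := by
  obtain ⟨Q, hQ, hu, hn⟩ := h
  refine ⟨T * Q, mul_mem_commutant hT hQ, (IsUnit.of_mul_eq_one_right _ hTT).mul hu, ?_⟩
  rw [Matrix.mul_inv_rev, Matrix.inv_eq_left_inv hTT]
  simpa only [Matrix.mul_assoc] using hn

theorem QStable.mono {𝕜 : Type*} [RCLike 𝕜] {ι : Type*} [Fintype ι] [DecidableEq ι]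
    {S S' : Set (Matrix ι ι 𝕜)} {M : Matrix ι ι 𝕜} (hS : S' ⊆ S) (h : QStable S M) :
    QStable S' M := by
  obtain ⟨Q, hQ, h⟩ := h
  exact ⟨Q, fun D hD => hQ D (hS hD), h⟩

theorem QStable.submatrix_equiv {𝕜 : Type*} [RCLike 𝕜] {ι κ : Type*} [Fintype ι] [DecidableEq ι]
    [Fintype κ] [DecidableEq κ] {S : Set (Matrix ι ι 𝕜)} {M : Matrix ι ι 𝕜} (e : κ ≃ ι)
    (h : QStable S M) : QStable ((fun D => D.submatrix e e) '' S) (M.submatrix e e) := by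
  obtain ⟨Q, hQ, hu, hn⟩ := h
  refine ⟨Q.submatrix e e, ?_, ?_, ?_⟩
  · rintro _ ⟨D, hD, rfl⟩
    simp only [submatrix_mul_equiv, hQ D hD]
  · rwa [isUnit_submatrix_equiv]
  · rw [inv_submatrix_equiv, submatrix_mul_equiv, submatrix_mul_equiv]
    rw [l2_opNorm_lt_one_iff_posDef] at hn ⊢
    rw [conjTranspose_submatrix, submatrix_mul_equiv, ← submatrix_one_equiv e]
    exact hn.submatrix e.injective

/-! ### The LMIs as Lyapunov inequalities on a kernel. -/

theorem posDef_fromBlocks_one_iff {𝕜 : Type*} [RCLike 𝕜] {ι κ : Type*} [Fintype ι] [DecidableEq ι]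
    [Fintype κ] [DecidableEq κ] (T : Matrix ι ι 𝕜) (b : Matrix ι κ 𝕜) :
    (fromBlocks T b bᴴ 1).PosDef ↔ (T - b * bᴴ).PosDef := by
  set U : Matrix (ι ⊕ κ) (ι ⊕ κ) 𝕜 := fromBlocks 1 0 bᴴ 1 with hU
  have hUu : IsUnit U := by simp [Matrix.isUnit_iff_isUnit_det, hU]
  have hfac : fromBlocks T b bᴴ 1 = star U * fromBlocks (T - b * bᴴ) 0 0 1 * U := by
    rw [hU, star_eq_conjTranspose, fromBlocks_conjTranspose, fromBlocks_multiply,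
      fromBlocks_multiply]
    simp
  rw [hfac, Matrix.IsUnit.posDef_star_left_conjugate_iff hUu]
  exact ⟨fun h => h.submatrix Sum.inl_injective, fun h => posDef_fromBlocks_diag h .one⟩

/-- The system matrix `[A B₁; C₁ D₁₁]` of the plant without its control channel. -/
def Plant.openLoop {𝕜 χ : Type*} {p q r : ℕ} (P : Plant 𝕜 χ p q r) :
    Matrix (χ ⊕ Fin p) (χ ⊕ Fin p) 𝕜 :=
  fromBlocks P.A P.B₁ P.C₁ P.D₁₁

/-- The plant whose system matrix is the conjugate transpose. -/
def Plant.adjoint {𝕜 χ : Type*} [RCLike 𝕜] {p q r : ℕ} (P : Plant 𝕜 χ p q r) :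
    Plant 𝕜 χ p r q where
  A := P.Aᴴ
  B₁ := P.C₁ᴴ
  B₂ := P.C₂ᴴ
  C₁ := P.B₁ᴴ
  C₂ := P.B₂ᴴ
  D₁₁ := P.D₁₁ᴴ
  D₁₂ := P.D₂₁ᴴ
  D₂₁ := P.D₁₂ᴴ
  D₂₂ := P.D₂₂ᴴ

theorem Plant.openLoop_adjoint {𝕜 χ : Type*} [RCLike 𝕜] {p q r : ℕ} (P : Plant 𝕜 χ p q r) :
    P.adjoint.openLoop = P.openLoopᴴ := by
  simp [Plant.openLoop, Plant.adjoint, fromBlocks_conjTranspose]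

theorem yLMI_iff {𝕜 : Type*} [RCLike 𝕜] {χ : Type*} [Fintype χ] {p q r c : ℕ}
    (P : Plant 𝕜 χ p q r) (N : Matrix (χ ⊕ Fin p) (Fin c) 𝕜) (Y : Matrix χ χ 𝕜) :
    YLMI P N Y ↔ (Nᴴ * (fromBlocks Y 0 0 1 -
      P.openLoop * fromBlocks Y 0 0 1 * P.openLoopᴴ) * N).PosDef := by
  classical
  set b := -(Nᴴ * fromRows P.B₁ P.D₁₁) with hb
  set Φ := fromBlocks (P.A * Y * P.Aᴴ - Y) (P.A * Y * P.C₁ᴴ)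
    (P.C₁ * Y * P.Aᴴ) (P.C₁ * Y * P.C₁ᴴ - 1) with hΦ
  have h1 : -((fromBlocks N 0 0 (1 : Matrix (Fin p) (Fin p) 𝕜))ᴴ *
      fromBlocks Φ (fromRows P.B₁ P.D₁₁) (fromCols P.B₁ᴴ P.D₁₁ᴴ) (-1) *
      fromBlocks N 0 0 (1 : Matrix (Fin p) (Fin p) 𝕜)) =
      fromBlocks (-(Nᴴ * Φ * N)) b bᴴ 1 := by
    rw [fromBlocks_conjTranspose, fromBlocks_multiply, fromBlocks_multiply, fromBlocks_neg]
    simp [hb, conjTranspose_fromRows_eq_fromCols_conjTranspose]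
  have h2 : -(Nᴴ * Φ * N) - b * bᴴ = Nᴴ * (fromBlocks Y 0 0 1 -
      P.openLoop * fromBlocks Y 0 0 1 * P.openLoopᴴ) * N := by
    have h3 : fromBlocks Y 0 0 1 - P.openLoop * fromBlocks Y 0 0 1 * P.openLoopᴴ =
        -Φ - fromRows P.B₁ P.D₁₁ * (fromRows P.B₁ P.D₁₁)ᴴ := by
      rw [Plant.openLoop, hΦ, conjTranspose_fromRows_eq_fromCols_conjTranspose,
        fromRows_mul_fromCols, fromBlocks_conjTranspose, fromBlocks_multiply, fromBlocks_multiply]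
      simp only [sub_eq_add_neg, fromBlocks_neg, fromBlocks_add, Matrix.mul_zero, add_zero,
        zero_add, Matrix.mul_one]
      congr 1 <;> abel
    rw [h3, hb]
    simp only [conjTranspose_neg, conjTranspose_mul, conjTranspose_conjTranspose, Matrix.mul_sub,
      Matrix.sub_mul, Matrix.mul_neg, Matrix.neg_mul, neg_neg, Matrix.mul_assoc]
  rw [YLMI, h1, posDef_fromBlocks_one_iff, h2]

theorem xLMI_iff {𝕜 : Type*} [RCLike 𝕜] {χ : Type*} [Fintype χ] {p q r c : ℕ}
    (P : Plant 𝕜 χ p q r) (N : Matrix (χ ⊕ Fin p) (Fin c) 𝕜) (X : Matrix χ χ 𝕜) :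
    XLMI P N X ↔ (Nᴴ * (fromBlocks X 0 0 1 -
      P.openLoopᴴ * fromBlocks X 0 0 1 * P.openLoop) * N).PosDef := by
  have h : XLMI P N X ↔ YLMI P.adjoint N X := by
    simp [XLMI, YLMI, Plant.adjoint]
  rw [h, yLMI_iff, Plant.openLoop_adjoint, conjTranspose_conjTranspose]

/-! ### The structure with a full block and its commutant. -/

/-- The structure `diag (Δ, Δ_full)` with `Δ` in the uncertainty structure and an arbitrary full
block. -/
def fullBlockStructure (𝕜 : Type*) [RCLike 𝕜] {d : ℕ} (m n : Fin d → ℕ) (p : ℕ) :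
    Set (Matrix (StateIdx m n ⊕ Fin p) (StateIdx m n ⊕ Fin p) 𝕜) :=
  {E | ∃ (δ : (k : Fin d) → Matrix (Fin (m k)) (Fin (m k)) 𝕜) (δf : Matrix (Fin p) (Fin p) 𝕜),
    E = fromBlocks (uncertainty m n δ) 0 0 δf}

theorem conjTranspose_uncertainty {𝕜 : Type*} [RCLike 𝕜] {d : ℕ} (m n : Fin d → ℕ)
    (δ : (k : Fin d) → Matrix (Fin (m k)) (Fin (m k)) 𝕜) :
    (uncertainty m n δ)ᴴ = uncertainty m n fun k => (δ k)ᴴ := by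
  simp [uncertainty, blockDiagonal'_conjTranspose, conjTranspose_kronecker]

theorem conjTranspose_mem_fullBlockStructure {𝕜 : Type*} [RCLike 𝕜] {d : ℕ} {m n : Fin d → ℕ}
    {p : ℕ} : ∀ D ∈ fullBlockStructure 𝕜 m n p, Dᴴ ∈ fullBlockStructure 𝕜 m n p := by
  rintro _ ⟨δ, δf, rfl⟩
  exact ⟨fun k => (δ k)ᴴ, δfᴴ, by simp [fromBlocks_conjTranspose, conjTranspose_uncertainty]⟩

theorem conjTranspose_mem_sharedClosedLoopStructure {𝕜 : Type*} [RCLike 𝕜] {d : ℕ}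
    {m n nK : Fin d → ℕ} {p nf : ℕ} : ∀ D ∈ sharedClosedLoopStructure 𝕜 m n nK p nf,
      Dᴴ ∈ sharedClosedLoopStructure 𝕜 m n nK p nf := by
  rintro _ ⟨δ, δf, rfl⟩
  exact ⟨fun k => (δ k)ᴴ, δfᴴ, by
    simp [fromBlocks_conjTranspose, conjTranspose_uncertainty, conjTranspose_kronecker]⟩

theorem fromBlocks_mem_commutant_fullBlockStructure {𝕜 : Type*} [RCLike 𝕜] {d : ℕ}
    {m n : Fin d → ℕ} {p : ℕ} {Y : Matrix (StateIdx m n) (StateIdx m n) 𝕜}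
    (hY : Y ∈ commutant (uncertaintyStructure 𝕜 m n)) :
    fromBlocks Y 0 0 1 ∈ commutant (fullBlockStructure 𝕜 m n p) := by
  rintro _ ⟨δ, δf, rfl⟩
  rw [fromBlocks_multiply, fromBlocks_multiply]
  simp [hY _ ⟨δ, rfl⟩]

theorem uncertainty_zero {𝕜 : Type*} [RCLike 𝕜] {d : ℕ} (m n : Fin d → ℕ) :
    uncertainty (𝕜 := 𝕜) m n 0 = 0 := by
  simp only [uncertainty, Pi.zero_apply, zero_kronecker]
  exact blockDiagonal'_zero

theorem Matrix.PosDef.exists_smul_eq_one {𝕜 : Type*} [RCLike 𝕜] {ι : Type*} [Fintype ι]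
    [DecidableEq ι] {D : Matrix ι ι 𝕜} (hD : D.PosDef) (hcomm : ∀ E : Matrix ι ι 𝕜, D * E = E * D) :
    ∃ t : ℝ, 0 < t ∧ t • D = 1 := by
  rcases isEmpty_or_nonempty ι with hι | ⟨⟨i⟩⟩
  · exact ⟨1, one_pos, Subsingleton.elim _ _⟩
  · obtain ⟨y, rfl⟩ := mem_range_scalar_iff_commute_single'.2 fun i j => (hcomm (single i j 1)).symm
    have hy : 0 < y := by simpa using hD.diag_pos (i := i)
    obtain ⟨x, hx, rfl⟩ := RCLike.pos_iff_exists_ofReal.1 hy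
    refine ⟨x⁻¹, inv_pos.2 hx, ?_⟩
    ext i j
    by_cases h : i = j <;> simp [h, one_apply, hx.ne', RCLike.real_smul_eq_coe_mul]

/-- Up to scaling, the positive-definite matrices that commute with the plant uncertainty and the
full block are of the form `diag (Y, I)`. -/
theorem exists_smul_eq_fromBlocks {𝕜 : Type*} [RCLike 𝕜] {d : ℕ} {m n : Fin d → ℕ} {p : ℕ}
    {W : Matrix (StateIdx m n ⊕ Fin p) (StateIdx m n ⊕ Fin p) 𝕜} (hW : W.PosDef)
    (hWS : W ∈ commutant (fullBlockStructure 𝕜 m n p)) :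
    ∃ Y ∈ commutant (uncertaintyStructure 𝕜 m n), Y.PosDef ∧
      ∃ t : ℝ, 0 < t ∧ t • W = fromBlocks Y 0 0 1 := by
  obtain ⟨a, b, c, D, rfl⟩ : ∃ a b c D, W = fromBlocks a b c D :=
    ⟨_, _, _, _, (fromBlocks_toBlocks W).symm⟩
  have key : ∀ δ δf, _ := fun δ δf => hWS _ ⟨δ, δf, rfl⟩
  simp only [fromBlocks_multiply, fromBlocks_inj, Matrix.mul_zero, Matrix.zero_mul, add_zero,
    zero_add] at key
  -- Testing against `diag(0, I)` kills the off-diagonal blocks.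
  obtain rfl : b = 0 := by simpa [uncertainty_zero] using (key 0 1).2.1
  obtain rfl : c = 0 := by simpa [uncertainty_zero] using (key 0 1).2.2.1.symm
  have hD : D.PosDef := hW.submatrix Sum.inr_injective
  obtain ⟨t, ht, htD⟩ := hD.exists_smul_eq_one fun E => (key 0 E).2.2.2
  refine ⟨t • a, ?_, PosDef.smul (hW.submatrix Sum.inl_injective : a.PosDef) ht, t, ht, ?_⟩
  · rintro _ ⟨δ, rfl⟩
    rw [Matrix.smul_mul, Matrix.mul_smul, (key δ 0).1]
  · rw [fromBlocks_smul, htD]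
    simp

/-! ### Necessity: compression of closed-loop certificates. -/

theorem fromRows_add_fromRows {R a b c : Type*} [Add R] (A A' : Matrix a c R)
    (B B' : Matrix b c R) : fromRows A B + fromRows A' B' = fromRows (A + A') (B + B') := by
  ext (i | i) j <;> rfl

theorem IsKernelMatrix.injective_mulVec_mul {𝕜 : Type*} [RCLike 𝕜] {a b e : Type*} [Fintype b]
    {c : ℕ} {N : Matrix b (Fin c) 𝕜} {C : Matrix a b 𝕜}
    (h : IsKernelMatrix N C) {J : Matrix e b 𝕜} (hJ : Function.Injective J.mulVec) :
    Function.Injective (J * N).mulVec := by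
  have : (J * N).mulVec = J.mulVec ∘ N.mulVec := by
    ext1 x; simp [mulVec_mulVec]
  rw [this]
  exact hJ.comp h.1

/-- Compression of a Lyapunov inequality to a subspace on which `T` acts as `R`. -/
theorem Matrix.PosDef.compress {𝕜 : Type*} [RCLike 𝕜] {ι β γ : Type*} [Fintype ι] [Fintype β]
    [Fintype γ] {W T : Matrix ι ι 𝕜} {J : Matrix ι β 𝕜} {R : Matrix β β 𝕜} {N : Matrix β γ 𝕜}
    (h : (W - Tᴴ * W * T).PosDef) (hJN : Function.Injective (J * N).mulVec)
    (hT : T * (J * N) = J * (R * N)) :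
    (Nᴴ * (Jᴴ * W * J - Rᴴ * (Jᴴ * W * J) * R) * N).PosDef := by
  convert h.conjTranspose_mul_mul_same hJN using 1
  have h1 : (J * N)ᴴ * (Tᴴ * W * T) * (J * N) = (T * (J * N))ᴴ * W * (T * (J * N)) := by
    simp only [conjTranspose_mul, Matrix.mul_assoc]
  rw [Matrix.mul_sub, Matrix.sub_mul, Matrix.mul_sub, Matrix.sub_mul, h1, hT]
  simp only [conjTranspose_mul, Matrix.mul_assoc]

/-- The embedding of `𝒳 ⊕ 𝒰₁` into `(𝒳 ⊕ 𝒳_K) ⊕ 𝒰₁`. -/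
def plantEmbedding (𝕜 χ κ π : Type*) [RCLike 𝕜] [DecidableEq χ] [DecidableEq π] :
    Matrix ((χ ⊕ κ) ⊕ π) (χ ⊕ π) 𝕜 :=
  fromBlocks (fromRows 1 0) 0 0 1

theorem plantEmbedding_conjTranspose_mul_self {𝕜 χ κ π : Type*} [RCLike 𝕜] [DecidableEq χ]
    [DecidableEq π] [Fintype χ] [Fintype κ] [Fintype π] :
    (plantEmbedding 𝕜 χ κ π)ᴴ * plantEmbedding 𝕜 χ κ π = 1 := by
  simp [plantEmbedding, fromBlocks_conjTranspose, conjTranspose_fromRows_eq_fromCols_conjTranspose,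
    fromBlocks_multiply, fromCols_mul_fromRows]

theorem injective_plantEmbedding_mulVec {𝕜 χ κ π : Type*} [RCLike 𝕜] [DecidableEq χ]
    [DecidableEq π] [Fintype χ] [Fintype κ] [Fintype π] :
    Function.Injective (plantEmbedding 𝕜 χ κ π).mulVec :=
  Function.LeftInverse.injective (g := (plantEmbedding 𝕜 χ κ π)ᴴ.mulVec) fun x => by
    rw [mulVec_mulVec, plantEmbedding_conjTranspose_mul_self, one_mulVec]

/-- The embedding and its adjoint intertwine the two structures, since the shared structure is block
diagonal and its plant and disturbance blocks form the smaller one. -/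
theorem compress_mem_commutant {𝕜 : Type*} [RCLike 𝕜] {d : ℕ} {m n nK : Fin d → ℕ} {p nf : ℕ}
    {W : Matrix ((StateIdx m n ⊕ ControllerIdx m nK p nf) ⊕ Fin p)
      ((StateIdx m n ⊕ ControllerIdx m nK p nf) ⊕ Fin p) 𝕜}
    (hW : W ∈ commutant (sharedClosedLoopStructure 𝕜 m n nK p nf)) :
    (plantEmbedding 𝕜 (StateIdx m n) (ControllerIdx m nK p nf) (Fin p))ᴴ * W *
      plantEmbedding 𝕜 (StateIdx m n) (ControllerIdx m nK p nf) (Fin p) ∈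
      commutant (fullBlockStructure 𝕜 m n p) := by
  rintro _ ⟨δ, δf, rfl⟩
  have h := hW _ ⟨δ, δf, rfl⟩
  set E : Matrix ((StateIdx m n ⊕ ControllerIdx m nK p nf) ⊕ Fin p)
      ((StateIdx m n ⊕ ControllerIdx m nK p nf) ⊕ Fin p) 𝕜 := fromBlocks
      (fromBlocks (uncertainty m n δ) 0 0
        (fromBlocks (uncertainty m nK δ) 0 0 (δf ⊗ₖ (1 : Matrix (Fin nf) (Fin nf) 𝕜))))
      0 0 δf with hE
  set J := plantEmbedding 𝕜 (StateIdx m n) (ControllerIdx m nK p nf) (Fin p) with hJ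
  have h1 : J * fromBlocks (uncertainty m n δ) 0 0 δf = E * J := by
    rw [hJ, hE, plantEmbedding, fromBlocks_multiply, fromBlocks_multiply]
    simp [fromRows_mul, fromBlocks_mul_fromRows]
  have h2 : fromBlocks (uncertainty m n δ) 0 0 δf * Jᴴ = Jᴴ * E := by
    rw [hJ, hE, plantEmbedding, fromBlocks_conjTranspose,
      conjTranspose_fromRows_eq_fromCols_conjTranspose, fromBlocks_multiply, fromBlocks_multiply]
    simp [mul_fromCols, fromCols_mul_fromBlocks]
  rw [Matrix.mul_assoc, h1, ← Matrix.mul_assoc _ (Jᴴ * W), ← Matrix.mul_assoc _ Jᴴ, h2,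
    Matrix.mul_assoc Jᴴ E W, ← h]
  simp only [Matrix.mul_assoc]

/-- A controller with state zero that measures zero stays silent: the last factor of the LFT
correction annihilates these vectors. -/
theorem closedLoop_mul_of_observation_eq_zero {𝕜 : Type*} [RCLike 𝕜] {χ κ γ : Type*} [Fintype χ]
    [Fintype κ] [DecidableEq κ] [DecidableEq χ] [Fintype γ] {p q r : ℕ}
    (P : Plant 𝕜 χ p q r) (K : Controller 𝕜 κ q r) {N : Matrix (χ ⊕ Fin p) γ 𝕜}
    (hN : fromCols P.C₂ P.D₂₁ * N = 0) :
    closedLoop P K * (plantEmbedding 𝕜 χ κ (Fin p) * N) =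
      plantEmbedding 𝕜 χ κ (Fin p) * (P.openLoop * N) := by
  obtain ⟨u, v, rfl⟩ : ∃ u v, N = fromRows u v := ⟨_, _, (fromRows_toRows N).symm⟩
  rw [fromCols_mul_fromRows] at hN
  rw [closedLoop, lowerLFT, Matrix.add_mul, Matrix.mul_assoc _ (fromCols _ _)]
  simp [plantEmbedding, Plant.openLoop, fromBlocks_mul_fromRows, fromRows_mul,
    fromCols_mul_fromRows, fromRows_add_fromRows, hN]

/-- Dually, the adjoint of the left factor of the LFT correction annihilates these vectors. -/
theorem conjTranspose_closedLoop_mul_of_actuation_eq_zero {𝕜 : Type*} [RCLike 𝕜] {χ κ γ : Type*}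
    [Fintype χ] [Fintype κ] [DecidableEq κ] [DecidableEq χ] [Fintype γ] {p q r : ℕ}
    (P : Plant 𝕜 χ p q r) (K : Controller 𝕜 κ q r) {N : Matrix (χ ⊕ Fin p) γ 𝕜}
    (hN : fromCols P.B₂ᴴ P.D₁₂ᴴ * N = 0) :
    (closedLoop P K)ᴴ * (plantEmbedding 𝕜 χ κ (Fin p) * N) =
      plantEmbedding 𝕜 χ κ (Fin p) * (P.openLoopᴴ * N) := by
  obtain ⟨u, v, rfl⟩ : ∃ u v, N = fromRows u v := ⟨_, _, (fromRows_toRows N).symm⟩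
  rw [fromCols_mul_fromRows] at hN
  rw [closedLoop, lowerLFT, conjTranspose_add, Matrix.add_mul, Matrix.mul_assoc (fromRows _ _),
    Matrix.mul_assoc (fromRows _ _), conjTranspose_mul (fromRows _ _),
    Matrix.mul_assoc _ (fromRows _ _)ᴴ]
  simp [plantEmbedding, Plant.openLoop, fromBlocks_mul_fromRows, fromRows_mul,
    fromCols_mul_fromRows, fromRows_add_fromRows, hN, fromBlocks_conjTranspose,
    conjTranspose_fromRows_eq_fromCols_conjTranspose,
    conjTranspose_fromCols_eq_fromRows_conjTranspose]

/-- A Lyapunov certificate of the closed loop yields a certificate of the plant. -/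
theorem exists_plant_certificate {𝕜 : Type*} [RCLike 𝕜] {d : ℕ} {m n nK : Fin d → ℕ} {p nf c : ℕ}
    {a : Type*} {C : Matrix a (StateIdx m n ⊕ Fin p) 𝕜}
    {N : Matrix (StateIdx m n ⊕ Fin p) (Fin c) 𝕜} (hN : IsKernelMatrix N C)
    {T : Matrix ((StateIdx m n ⊕ ControllerIdx m nK p nf) ⊕ Fin p)
      ((StateIdx m n ⊕ ControllerIdx m nK p nf) ⊕ Fin p) 𝕜}
    {R : Matrix (StateIdx m n ⊕ Fin p) (StateIdx m n ⊕ Fin p) 𝕜}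
    (hT : T * (plantEmbedding 𝕜 (StateIdx m n) (ControllerIdx m nK p nf) (Fin p) * N) =
      plantEmbedding 𝕜 (StateIdx m n) (ControllerIdx m nK p nf) (Fin p) * (R * N))
    (h : QStable (sharedClosedLoopStructure 𝕜 m n nK p nf) T) :
    ∃ Y ∈ commutant (uncertaintyStructure 𝕜 m n), Y.PosDef ∧
      (Nᴴ * (fromBlocks Y 0 0 1 - Rᴴ * fromBlocks Y 0 0 1 * R) * N).PosDef := by
  obtain ⟨W, hWS, hW, hWT⟩ := h.exists_posDef conjTranspose_mem_sharedClosedLoopStructure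
  obtain ⟨Y, hY, hYpos, t, ht, htW⟩ := exists_smul_eq_fromBlocks
    (hW.conjTranspose_mul_mul_same injective_plantEmbedding_mulVec) (compress_mem_commutant hWS)
  refine ⟨Y, hY, hYpos, ?_⟩
  have := PosDef.smul
    (hWT.compress (hN.injective_mulVec_mul injective_plantEmbedding_mulVec) hT) ht
  rw [← htW]
  convert this using 1
  simp only [Matrix.mul_smul, Matrix.smul_mul, ← smul_sub]

/-! ### Sufficiency: the observer-based controller. -/

theorem closedLoop_of_strictlyProper {𝕜 : Type*} [RCLike 𝕜] {χ κ : Type*} [Fintype χ]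
    [Fintype κ] [DecidableEq κ] {p q r : ℕ} (P : Plant 𝕜 χ p q r) (K : Controller 𝕜 κ q r)
    (hK : K.D = 0) :
    closedLoop P K = fromBlocks
      (fromBlocks P.A (P.B₂ * K.C) (K.B * P.C₂) (K.A + K.B * P.D₂₂ * K.C))
      (fromRows P.B₁ (K.B * P.D₂₁)) (fromCols P.C₁ (P.D₁₂ * K.C)) P.D₁₁ := by
  have hinv : (1 - fromBlocks K.A K.B K.C K.D *
      fromBlocks (0 : Matrix κ κ 𝕜) 0 0 P.D₂₂)⁻¹ = fromBlocks 1 (K.B * P.D₂₂) 0 1 := by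
    -- With `D_K = 0` the matrix to be inverted is unipotent upper triangular.
    refine Matrix.inv_eq_left_inv ?_
    rw [← fromBlocks_one, fromBlocks_multiply, sub_eq_add_neg, fromBlocks_neg, fromBlocks_add,
      fromBlocks_multiply]
    simp [hK]
  rw [closedLoop, lowerLFT, hinv, Matrix.mul_assoc (fromRows _ _), fromBlocks_multiply,
    Matrix.mul_assoc (fromRows _ _), mul_fromCols, fromRows_mul, fromBlocks_multiply]
  ext ((i | i) | i) ((j | j) | j) <;>
    simp [hK, fromCols_mul_fromBlocks, fromBlocks_mul_fromRows, fromCols_mul_fromRows, mul_fromCols,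
      fromBlocks_multiply]

/-- The observer-based controller with state-feedback gain `F` and output-injection gain `L`, whose
state estimates both the state and the disturbance. -/
def observerController {𝕜 : Type*} [RCLike 𝕜] {χ : Type*} [Fintype χ] {p q r : ℕ}
    (P : Plant 𝕜 χ p q r) (F : Matrix (Fin q) (χ ⊕ Fin p) 𝕜) (L : Matrix (χ ⊕ Fin p) (Fin r) 𝕜) :
    Controller 𝕜 (χ ⊕ Fin p) q r where
  -- The term `L D₂₂ F` cancels the feedthrough of `D₂₂` into the measurement, so `D₂₂` drops out of
  -- the closed loop.
  A := P.openLoop + fromRows P.B₂ P.D₁₂ * F + L * fromCols P.C₂ P.D₂₁ + L * P.D₂₂ * F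
  B := -L
  C := F
  D := 0

/-- Change of the coordinates of the state space of a controller. -/
def Controller.reindex {𝕜 : Type*} {κ κ' : Type*} {q r : ℕ} (K : Controller 𝕜 κ q r)
    (e : κ' ≃ κ) : Controller 𝕜 κ' q r where
  A := K.A.submatrix e e
  B := K.B.submatrix e id
  C := K.C.submatrix id e
  D := K.D

theorem closedLoop_reindex_of_strictlyProper {𝕜 : Type*} [RCLike 𝕜] {χ κ κ' : Type*} [Fintype χ]
    [Fintype κ] [DecidableEq κ] [Fintype κ'] [DecidableEq κ'] {p q r : ℕ} (P : Plant 𝕜 χ p q r)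
    (K : Controller 𝕜 κ q r) (hK : K.D = 0) (e : κ' ≃ κ) :
    closedLoop P (K.reindex e) = (closedLoop P K).submatrix
      (Sum.map (Sum.map id e) id) (Sum.map (Sum.map id e) id) := by
  rw [closedLoop_of_strictlyProper P K hK, closedLoop_of_strictlyProper P (K.reindex e) hK]
  ext ((i | i) | i) ((j | j) | j) <;> simp [Controller.reindex, Matrix.mul_apply]

/-- Regrouping of `(𝒳 ⊕ (𝒳 ⊕ 𝒰₁)) ⊕ 𝒰₁`. -/
def regroup (χ π : Type*) : (χ ⊕ (χ ⊕ π)) ⊕ π ≃ (χ ⊕ π) ⊕ (χ ⊕ π) where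
  toFun := Sum.elim (Sum.elim (Sum.inl ∘ Sum.inl) Sum.inr) (Sum.inl ∘ Sum.inr)
  invFun := Sum.elim (Sum.elim (Sum.inl ∘ Sum.inl) Sum.inr) (Sum.inl ∘ Sum.inr)
  left_inv := by rintro ((i | i) | i) <;> rfl
  right_inv := by rintro ((i | i) | i) <;> rfl

theorem closedLoop_observerController {𝕜 : Type*} [RCLike 𝕜] {χ : Type*} [Fintype χ]
    [DecidableEq χ] {p q r : ℕ}
    (P : Plant 𝕜 χ p q r) (F : Matrix (Fin q) (χ ⊕ Fin p) 𝕜) (L : Matrix (χ ⊕ Fin p) (Fin r) 𝕜) :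
    closedLoop P (observerController P F L) =
      (fromBlocks P.openLoop (fromRows P.B₂ P.D₁₂ * F) (-(L * fromCols P.C₂ P.D₂₁))
        (P.openLoop + fromRows P.B₂ P.D₁₂ * F + L * fromCols P.C₂ P.D₂₁)).submatrix
        (regroup χ (Fin p)) (regroup χ (Fin p)) := by
  rw [closedLoop_of_strictlyProper _ _ rfl, fromRows_mul, mul_fromCols]
  ext ((i | i) | i) ((j | j) | j) <;>
    simp [observerController, regroup, Plant.openLoop]

/-- The separation principle. -/
theorem QStable.fromBlocks_observer {𝕜 : Type*} [RCLike 𝕜] {ι : Type*} [Fintype ι]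
    [DecidableEq ι] {S : Set (Matrix ι ι 𝕜)} {M : Matrix ι ι 𝕜}
    {b c : Matrix ι ι 𝕜} (hb : QStable S (M + b)) (hc : QStable S (M + c)) :
    QStable {E | ∃ D ∈ S, E = fromBlocks D 0 0 D} (fromBlocks M b (-c) (M + b + c)) := by
  -- Replacing the estimate by the estimation error makes the system block triangular with diagonal
  -- blocks `M + b` and `M + c`. The shear is admissible because both copies carry the same `D`.
  refine QStable.of_similar (T := fromBlocks 1 0 1 1) (T' := fromBlocks 1 0 (-1) 1) ?_ ?_ ?_
  · rintro _ ⟨D, -, rfl⟩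
    simp [fromBlocks_multiply]
  · simp [fromBlocks_multiply]
  · convert (hb.fromBlocks_upper (b := b) hc).mono ?_ using 1
    · rw [fromBlocks_multiply, fromBlocks_multiply]
      simp only [Matrix.one_mul, Matrix.mul_one, Matrix.zero_mul, Matrix.mul_zero, Matrix.neg_mul,
        add_zero, zero_add]
      congr 1 <;> abel
    · rintro _ ⟨D, hD, rfl⟩
      exact ⟨D, hD, D, hD, rfl⟩

theorem qStable_closedLoop_observerController {𝕜 : Type*} [RCLike 𝕜] {d : ℕ} {m n : Fin d → ℕ}
    {p q r : ℕ} (P : Plant 𝕜 (StateIdx m n) p q r) (F : Matrix (Fin q) (StateIdx m n ⊕ Fin p) 𝕜)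
    (L : Matrix (StateIdx m n ⊕ Fin p) (Fin r) 𝕜)
    (hF : QStable (fullBlockStructure 𝕜 m n p) (P.openLoop + fromRows P.B₂ P.D₁₂ * F))
    (hL : QStable (fullBlockStructure 𝕜 m n p) (P.openLoop + L * fromCols P.C₂ P.D₂₁)) :
    QStable (sharedClosedLoopStructure 𝕜 m n n p 1)
      (closedLoop P ((observerController P F L).reindex
        (Equiv.sumCongr (.refl _) (Equiv.prodUnique (Fin p) (Fin 1))))) := by
  rw [closedLoop_reindex_of_strictlyProper _ _ rfl, closedLoop_observerController,
    submatrix_submatrix]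
  let e : (StateIdx m n ⊕ ControllerIdx m n p 1) ⊕ Fin p ≃
      (StateIdx m n ⊕ Fin p) ⊕ (StateIdx m n ⊕ Fin p) :=
    (Equiv.sumCongr (Equiv.sumCongr (.refl _) (Equiv.sumCongr (.refl _)
      (Equiv.prodUnique (Fin p) (Fin 1)))) (.refl _)).trans (regroup (StateIdx m n) (Fin p))
  refine ((hF.fromBlocks_observer hL).submatrix_equiv e).mono ?_
  -- After regrouping, plant and controller each carry the same copy of `diag(Δ, Δ_full)`; this is
  -- where sharing the full block is essential.
  rintro _ ⟨δ, δf, rfl⟩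
  refine ⟨_, ⟨_, ⟨δ, δf, rfl⟩, rfl⟩, ?_⟩
  ext ((i | i | ⟨i, _⟩) | i) ((j | j | ⟨j, _⟩) | j) <;>
    simp [e, regroup, one_apply, eq_iff_true_of_subsingleton]

theorem exists_observer_gains {𝕜 : Type*} [RCLike 𝕜] {d : ℕ} {m n : Fin d → ℕ} {p a c : ℕ}
    {C : Matrix (Fin a) (StateIdx m n ⊕ Fin p) 𝕜}
    {N : Matrix (StateIdx m n ⊕ Fin p) (Fin c) 𝕜} (hN : IsKernelMatrix N C)
    {R : Matrix (StateIdx m n ⊕ Fin p) (StateIdx m n ⊕ Fin p) 𝕜}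
    {X : Matrix (StateIdx m n) (StateIdx m n) 𝕜}
    (hXS : X ∈ commutant (uncertaintyStructure 𝕜 m n)) (hX : X.PosDef)
    (h : (Nᴴ * (fromBlocks X 0 0 1 - Rᴴ * fromBlocks X 0 0 1 * R) * N).PosDef) :
    ∃ L : Matrix (StateIdx m n ⊕ Fin p) (Fin a) 𝕜,
      QStable (fullBlockStructure 𝕜 m n p) (R + L * C) := by
  have hpos := posDef_fromBlocks_diag hX (Matrix.PosDef.one (n := Fin p) (R := 𝕜))
  obtain ⟨L, hL⟩ := hN.exists_injection hpos h
  exact ⟨L, .of_posDef (fromBlocks_mem_commutant_fullBlockStructure hXS) hpos hL⟩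

theorem theorem4p1 {𝕜 : Type*} [RCLike 𝕜] {d : ℕ} (m n : Fin d → ℕ) {p q r : ℕ}
    (P : Plant 𝕜 (StateIdx m n) p q r)
    {c o : ℕ}
    (Nc : Matrix (StateIdx m n ⊕ Fin p) (Fin c) 𝕜)
    (No : Matrix (StateIdx m n ⊕ Fin p) (Fin o) 𝕜)
    (hNc : IsKernelMatrix Nc (Matrix.fromCols P.B₂ᴴ P.D₁₂ᴴ))
    (hNo : IsKernelMatrix No (Matrix.fromCols P.C₂ P.D₂₁)) :
    (∃ (nK : Fin d → ℕ) (nf : ℕ) (K : Controller 𝕜 (ControllerIdx m nK p nf) q r),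
        WellPosed P K ∧
          QStable (sharedClosedLoopStructure 𝕜 m n nK p nf) (closedLoop P K)) ↔
      ∃ X ∈ commutant (uncertaintyStructure 𝕜 m n),
        ∃ Y ∈ commutant (uncertaintyStructure 𝕜 m n),
          X.PosDef ∧ Y.PosDef ∧ YLMI P Nc Y ∧ XLMI P No X := by
  constructor
  · rintro ⟨nK, nf, K, -, hK⟩
    obtain ⟨X, hXS, hX, hXN⟩ := exists_plant_certificate hNo
      (closedLoop_mul_of_observation_eq_zero P K hNo.mul_eq_zero) hK
    obtain ⟨Y, hYS, hY, hYN⟩ := exists_plant_certificate hNc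
      (conjTranspose_closedLoop_mul_of_actuation_eq_zero P K hNc.mul_eq_zero)
      (hK.conjTranspose conjTranspose_mem_sharedClosedLoopStructure)
    rw [conjTranspose_conjTranspose] at hYN
    exact ⟨X, hXS, Y, hYS, hX, hY, (yLMI_iff P Nc Y).2 hYN, (xLMI_iff P No X).2 hXN⟩
  · rintro ⟨X, hXS, Y, hYS, hX, hY, hYN, hXN⟩
    rw [xLMI_iff] at hXN
    rw [yLMI_iff] at hYN
    obtain ⟨L, hL⟩ := exists_observer_gains hNo hXS hX hXN
    -- State feedback is output injection for the adjoint system.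
    obtain ⟨F, hF⟩ := exists_observer_gains (R := P.openLoopᴴ) hNc hYS hY
      (by rwa [conjTranspose_conjTranspose])
    have hF' := hF.conjTranspose conjTranspose_mem_fullBlockStructure
    rw [conjTranspose_add, conjTranspose_conjTranspose, conjTranspose_mul,
      conjTranspose_fromCols_eq_fromRows_conjTranspose, conjTranspose_conjTranspose,
      conjTranspose_conjTranspose] at hF'
    -- The observer copies `𝒳 ⊕ 𝒰₁`, hence `n_K = n` and `n_f = 1`; its zero `D_K` makes the loop
    -- well-posed for every `D₂₂`.
    exact ⟨n, 1, _, by simp [WellPosed, Controller.reindex, observerController],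
      qStable_closedLoop_observerController P Fᴴ L hF' hL⟩
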